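/- Let $G=(V,E)$ be a finite nonempty undirected graph (parallel edges and loops are allowed; simple graphs are a special case) that has a strongly connected orientation. For an orientation of $G$ let $\delta(v)$ denote the indegree of the vertex $v$. A directed path is a sequence of distinct arcs $a_1,\dots,a_k$ ($k\ge 0$) in which the head of $a_i$ is the tail of $a_{i+1}$. In a strongly connected orientation, a directed path from $u$ to $v$ is strongly reversible if $\delta(u)<\delta(v)-1$ and reversing all arcs of the path maintains strong connectivity. The algorithm SC-Path-Reversal starts with an arbitrary strongly connected orientation of $G$ and, as long as there is a strongly reversible path that ends in a vertex of maximum indegree, chooses any such path and reverses each of its arcs. For $U\subseteq V$ let $m(U)$ be the number of edges of the induced subgraph $G[U]$, and let $c(U)$ be the number of connected components of $G[V\setminus U]$. Theorem. (1) SC-Path-Reversal terminates, for every initial strongly connected orientation and all choices of paths. (2) Every orientation that it can return is a strongly connected orientation of $G$ whose maximum indegree is minimum among all strongly connected orientations of $G$, and this maximum indegree equals $$\max_{\emptyset\ne U\subseteq V}\left\lceil\frac{m(U)+c(U)}{|U|}\right\rceil .$$ (3) In a strongly connected orientation of $G$, reversing the arcs of a directed path from $u$ to $v$ maintains strong connectivity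 if and only if there are two arc-disjoint directed paths from $u$ to $v$. -/

import Mathlib

open scoped Graph

noncomputable section

namespace Graph

variable {α β : Type*}

/-- An orientation of an undirected (multi)graph `G`: every edge `e` becomes an arc, directed from
the vertex `tail e` to the vertex `head e`, these two vertices being the ends of `e` in `G`. -/
@[ext]
structure Orientation (G : Graph α β) where
  tail : E(G) → V(G)
  head : E(G) → V(G)
  isLink : ∀ e : E(G), G.IsLink e (tail e) (head e)

/-- `m(U)`: the number of edges of the induced subgraph `G[U]`. -/
def numEdgesInside (G : Graph α β) (U : Set α) : ℕ := E(G.induce U).ncard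

/-- The number of connected components of `H`, that is, of classes of vertices of `H` under the
equivalence relation generated by adjacency. -/
def numComponents (H : Graph α β) : ℕ := Nat.card (Quot fun x y : V(H) => H.Adj x y)

/-- `c(U)`: the number of connected components of `G[V \ U]`. -/
def numComponentsOutside (G : Graph α β) (U : Set α) : ℕ := (G.deleteVerts U).numComponents

namespace Orientation

variable {G : Graph α β}

/-- The indegree `δ(v)`: the number of arcs with head `v`. -/
def indegree (O : G.Orientation) (v : V(G)) : ℕ := {e : E(G) | O.head e = v}.ncard

/-- The maximum indegree (used for finite nonempty graphs only). -/
def maxIndegree (O : G.Orientation) : ℕ := ⨆ v : V(G), O.indegree v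

/-- `O.IsWalk u p v`: the arcs in the list `p`, in this order, lead from `u` to `v`, the head of
each arc being the tail of the next one; the empty list leads from a vertex to itself. -/
def IsWalk (O : G.Orientation) : V(G) → List E(G) → V(G) → Prop
  | u, [], v => u = v
  | u, e :: p, v => O.tail e = u ∧ O.IsWalk (O.head e) p v

/-- A directed path from `u` to `v`: a sequence of distinct arcs, consecutive ones being joined
head to tail, from `u` to `v`. Vertices may be repeated; the trivial path has no arcs. -/
def IsPath (O : G.Orientation) (u : V(G)) (p : List E(G)) (v : V(G)) : Prop :=
  O.IsWalk u p v ∧ p.Nodup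

/-- There are directed paths from every vertex to every vertex. -/
def StronglyConnected (O : G.Orientation) : Prop :=
  ∀ u v : V(G), ∃ p : List E(G), O.IsPath u p v

open Classical in
/-- The orientation obtained from `O` by reversing each arc of `p`. -/
def reverse (O : G.Orientation) (p : List E(G)) : G.Orientation where
  tail e := if e ∈ p then O.head e else O.tail e
  head e := if e ∈ p then O.tail e else O.head e
  isLink e := by
    split
    · exact (O.isLink e).symm
    · exact O.isLink e

/-- `u` two-reaches `v`: there are two arc-disjoint directed paths from `u` to `v`. -/
def TwoReaches (O : G.Orientation) (u v : V(G)) : Prop :=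
  ∃ p q : List E(G), O.IsPath u p v ∧ O.IsPath u q v ∧ p.Disjoint q

/-- `p` is a strongly reversible path from `u` to `v`: `δ(u) < δ(v) - 1`, and reversing `p`
maintains strong connectivity. -/
def StronglyReversible (O : G.Orientation) (u : V(G)) (p : List E(G)) (v : V(G)) : Prop :=
  O.IsPath u p v ∧ O.indegree u + 1 < O.indegree v ∧ (O.reverse p).StronglyConnected

/-- One iteration of the loop of SC-Path-Reversal: pick any strongly reversible path that ends in
a vertex of maximum indegree, and reverse it. -/
def SCPathReversalStep (O O' : G.Orientation) : Prop :=
  ∃ (u v : V(G)) (p : List E(G)), (∀ w, O.indegree w ≤ O.indegree v) ∧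
    O.StronglyReversible u p v ∧ O' = O.reverse p

/-- `O` is a possible result of SC-Path-Reversal: it is reached from some strongly connected
orientation by finitely many iterations of the loop, and no further iteration is possible. -/
def IsSCPathReversalResult (O : G.Orientation) : Prop :=
  ∃ O₀ : G.Orientation, O₀.StronglyConnected ∧
    Relation.ReflTransGen SCPathReversalStep O₀ O ∧ ¬ ∃ O', SCPathReversalStep O O'

end Orientation

end Graph

end

namespace Graph

namespace Orientation

/-! Strong connectivity means that every proper nonempty vertex set is left by an arc. Reversing a
path from `u` to `v` lowers the outdegree of a set by one if it separates `u` from `v`, and never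
lowers it otherwise, so only sets left by a single arc ("tight" sets) can obstruct a reversal.
Menger's argument for two paths turns this into part (3). Each step moves one unit of indegree
between vertices whose indegrees differ by at least two, so the sum of squared indegrees drops and
the algorithm stops. Lower bound: the indegrees in `U` sum to `m(U)` plus the number of arcs
entering `U`, and each component of `G[V \ U]` must send an arc into `U`. For equality at a final
orientation, let `v` have maximum indegree `k` and let `U` be the vertices that two-reach `v`. All
indegrees in `U` are at least `k - 1`, or a further step would exist. Uncrossing tight sets
(`outDegree_union_eq_one`) shows that each component sends only one arc into `U`, so `k` is at most
the bound for `U`. -/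

open Classical in
/-- The indicator function of a set of vertices, with integer values. -/
noncomputable def ind {α : Type*} (S : Set α) (x : α) : ℤ := if x ∈ S then 1 else 0

variable {α β : Type*} {G : Graph α β} {O : G.Orientation}

/-- The number of arcs that leave the set `S` of vertices. -/
noncomputable def outDegree (O : G.Orientation) (S : Set V(G)) : ℕ :=
  {e : E(G) | O.tail e ∈ S ∧ O.head e ∉ S}.ncard

/-! ### Directed paths and cuts -/

section Walks

theorem isWalk_append {u v : V(G)} {p q : List E(G)} :
    O.IsWalk u (p ++ q) v ↔ ∃ w, O.IsWalk u p w ∧ O.IsWalk w q v := by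
  induction p generalizing u with
  | nil => simp [IsWalk]
  | cons e p ih => simp [IsWalk, ih, and_assoc]

theorem IsWalk.sum_map_sub {u v : V(G)} {p : List E(G)} (h : O.IsWalk u p v) (f : V(G) → ℤ) :
    (p.map fun e => f (O.tail e) - f (O.head e)).sum = f u - f v := by
  induction p generalizing u with
  | nil => obtain rfl : u = v := h; simp
  | cons e p ih =>
    obtain ⟨rfl, h⟩ := h
    simp [ih h]

open Classical in
theorem IsPath.sum_sub {u v : V(G)} {p : List E(G)} (h : O.IsPath u p v) (f : V(G) → ℤ) :
    ∑ e ∈ p.toFinset, (f (O.tail e) - f (O.head e)) = f u - f v := by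
  rw [List.sum_toFinset _ h.2, h.1.sum_map_sub]

theorem IsWalk.exists_leaving {u v : V(G)} {p : List E(G)} (h : O.IsWalk u p v)
    {S : Set V(G)} (hu : u ∈ S) (hv : v ∉ S) : ∃ e ∈ p, O.tail e ∈ S ∧ O.head e ∉ S := by
  induction p generalizing u with
  | nil => obtain rfl : u = v := h; exact absurd hu hv
  | cons e p ih =>
    obtain ⟨rfl, h⟩ := h
    by_cases he : O.head e ∈ S
    · obtain ⟨f, hf, hfS⟩ := ih h he
      exact ⟨f, List.mem_cons_of_mem _ hf, hfS⟩
    · exact ⟨e, List.mem_cons_self, hu, he⟩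

theorem exists_isPath_of_forall_leaving {u v : V(G)} (F : Set E(G))
    (h : ∀ S : Set V(G), u ∈ S → v ∉ S → ∃ e ∈ F, O.tail e ∈ S ∧ O.head e ∉ S) :
    ∃ p, O.IsPath u p v ∧ ∀ e ∈ p, e ∈ F := by
  by_contra hv
  obtain ⟨e, heF, ⟨p, hp, hpF⟩, he⟩ := h {w | ∃ p, O.IsPath u p w ∧ ∀ e ∈ p, e ∈ F}
    ⟨[], ⟨rfl, List.nodup_nil⟩, by simp⟩ hv
  refine he ?_
  -- If the leaving arc already occurs on the path, cutting the path off just after it keeps the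
  -- arcs distinct.
  by_cases hep : e ∈ p
  · obtain ⟨a, b, rfl⟩ := List.append_of_mem hep
    obtain ⟨w, hw, htail, -⟩ := isWalk_append.1 hp.1
    refine ⟨a ++ [e], ⟨isWalk_append.2 ⟨w, hw, htail, rfl⟩, hp.2.sublist ?_⟩, fun f hf => hpF f ?_⟩
    · simp
    · simp only [List.mem_append, List.mem_cons] at hf ⊢
      simp only [List.not_mem_nil, or_false] at hf
      tauto
  · refine ⟨p ++ [e], ⟨isWalk_append.2 ⟨_, hp.1, rfl, rfl⟩, ?_⟩, ?_⟩
    · exact List.nodup_append.2 ⟨hp.2, List.nodup_singleton e, fun f hf g hg hfg => hep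
        (List.mem_singleton.1 hg ▸ hfg ▸ hf)⟩
    · simp only [List.mem_append, List.mem_singleton]
      rintro f (hf | rfl)
      exacts [hpF f hf, heF]

theorem exists_isPath_of_sum_pos {u v : V(G)} (F : Finset E(G))
    (h : ∀ S : Set V(G), u ∈ S → v ∉ S →
      0 < ∑ e ∈ F, (ind S (O.tail e) - ind S (O.head e))) :
    ∃ p, O.IsPath u p v ∧ ∀ e ∈ p, e ∈ F := by
  refine exists_isPath_of_forall_leaving (F : Set E(G)) fun S hu hv => ?_
  by_contra! hS
  refine (h S hu hv).not_ge (Finset.sum_nonpos fun e he => ?_)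
  have := hS e he
  unfold ind
  split_ifs <;> simp_all

theorem stronglyConnected_iff :
    O.StronglyConnected ↔ ∀ S : Set V(G), S.Nonempty → Sᶜ.Nonempty →
      ∃ e, O.tail e ∈ S ∧ O.head e ∉ S := by
  constructor
  · rintro h S ⟨u, hu⟩ ⟨v, hv⟩
    obtain ⟨p, hp⟩ := h u v
    obtain ⟨e, -, he⟩ := hp.1.exists_leaving hu hv
    exact ⟨e, he⟩
  · intro h u v
    obtain ⟨p, hp, -⟩ := exists_isPath_of_forall_leaving (O := O) (u := u) (v := v) Set.univ
      fun S hu hv => by simpa using h S ⟨u, hu⟩ ⟨v, hv⟩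
    exact ⟨p, hp⟩

end Walks

/-! ### Path reversal, two-reachability and tight sets -/

section Reversal

variable [Fintype E(G)]

theorem outDegree_pos {S : Set V(G)} :
    0 < O.outDegree S ↔ ∃ e, O.tail e ∈ S ∧ O.head e ∉ S :=
  Set.ncard_pos (Set.toFinite _)

theorem StronglyConnected.outDegree_pos (h : O.StronglyConnected) {S : Set V(G)}
    (hS : S.Nonempty) (hS' : Sᶜ.Nonempty) : 0 < O.outDegree S :=
  Orientation.outDegree_pos.2 (stronglyConnected_iff.1 h S hS hS')

open Classical in
theorem outDegree_eq_sum (S : Set V(G)) :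
    (O.outDegree S : ℤ) = ∑ e, ind S (O.tail e) * (1 - ind S (O.head e)) := by
  rw [outDegree, Set.ncard_eq_toFinset_card', Finset.card_eq_sum_ones, Set.toFinset_ofPred,
    Finset.sum_filter]
  push_cast
  refine Finset.sum_congr rfl fun e _ => ?_
  unfold ind
  split_ifs <;> simp_all

open Classical in
theorem indegree_eq_sum (w : V(G)) :
    (O.indegree w : ℤ) = ∑ e, ind {w} (O.head e) := by
  rw [indegree, Set.ncard_eq_toFinset_card', Finset.card_eq_sum_ones, Set.toFinset_ofPred,
    Finset.sum_filter]
  push_cast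
  exact Finset.sum_congr rfl fun e _ => by simp [ind]

-- When swapping the arguments of `f` changes it by a potential difference, the changes telescope
-- along the path. Cut sizes and indegrees are both of this kind.
open Classical in
theorem IsPath.sum_reverse {u v : V(G)} {p : List E(G)} (h : O.IsPath u p v)
    (f : V(G) → V(G) → ℤ) (g : V(G) → ℤ) (hfg : ∀ x y, f y x = f x y - (g x - g y)) :
    ∑ e, f ((O.reverse p).tail e) ((O.reverse p).head e) =
      ∑ e, f (O.tail e) (O.head e) - (g u - g v) := by
  rw [← h.sum_sub g, ← Finset.univ_inter p.toFinset, ← Finset.sum_ite_mem,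
    ← Finset.sum_sub_distrib]
  refine Finset.sum_congr rfl fun e _ => ?_
  by_cases he : e ∈ p
  · simp only [reverse, he, if_true, List.mem_toFinset]
    exact hfg _ _
  · simp [reverse, he]

theorem IsPath.outDegree_reverse {u v : V(G)} {p : List E(G)} (h : O.IsPath u p v)
    (S : Set V(G)) :
    ((O.reverse p).outDegree S : ℤ) = O.outDegree S - (ind S u - ind S v) := by
  rw [outDegree_eq_sum, outDegree_eq_sum]
  exact h.sum_reverse (fun x y => ind S x * (1 - ind S y)) (ind S) fun x y => by ring

theorem IsPath.indegree_reverse {u v : V(G)} {p : List E(G)} (h : O.IsPath u p v) (w : V(G)) :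
    ((O.reverse p).indegree w : ℤ) = O.indegree w + ind {w} u - ind {w} v := by
  rw [indegree_eq_sum, indegree_eq_sum,
    h.sum_reverse (fun _ y => ind {w} y) (fun x => -ind {w} x) fun x y => by ring]
  ring

theorem TwoReaches.one_lt_outDegree {u v : V(G)} (h : O.TwoReaches u v) {S : Set V(G)}
    (hu : u ∈ S) (hv : v ∉ S) : 1 < O.outDegree S := by
  obtain ⟨p, q, hp, hq, hpq⟩ := h
  obtain ⟨e, he, heS⟩ := hp.1.exists_leaving hu hv
  obtain ⟨f, hf, hfS⟩ := hq.1.exists_leaving hu hv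
  refine (Set.one_lt_ncard (Set.toFinite _)).2 ⟨e, heS, f, hfS, ?_⟩
  rintro rfl
  exact hpq he hf

theorem stronglyConnected_iff_outDegree_pos :
    O.StronglyConnected ↔ ∀ S : Set V(G), S.Nonempty → Sᶜ.Nonempty → 0 < O.outDegree S := by
  simp only [stronglyConnected_iff, outDegree_pos]

-- An augmenting-path argument: a path `q` of the reversed orientation is superposed on `p`. Arcs on
-- both cancel, which leaves a set `F` carrying two units of flow from `u` to `v` in `O`.
open Classical in
theorem IsPath.twoReaches {u v : V(G)} {p : List E(G)} (hp : O.IsPath u p v)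
    (h : (O.reverse p).StronglyConnected) : O.TwoReaches u v := by
  obtain ⟨q, hq⟩ := h u v
  set F : Finset E(G) := {e | ¬(e ∈ p ↔ e ∈ q)} with hF
  have hsum (g : V(G) → ℤ) : ∑ e ∈ F, (g (O.tail e) - g (O.head e)) = 2 * (g u - g v) := by
    rw [two_mul]
    nth_rw 1 [← hp.sum_sub g]
    rw [← hq.sum_sub g, ← Finset.univ_inter p.toFinset, ← Finset.univ_inter q.toFinset,
      ← Finset.sum_ite_mem, ← Finset.sum_ite_mem, ← Finset.sum_add_distrib, hF,
      Finset.sum_filter]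
    refine Finset.sum_congr rfl fun e _ => ?_
    by_cases hep : e ∈ p <;> by_cases heq : e ∈ q <;> simp [reverse, hep, heq]
  obtain ⟨p₁, hp₁, hp₁F⟩ := exists_isPath_of_sum_pos (O := O) (u := u) (v := v) F
    fun S hu hv => by rw [hsum]; simp [ind, hu, hv]
  have hsub : p₁.toFinset ⊆ F := fun e he => hp₁F e (List.mem_toFinset.1 he)
  -- Removing `p₁` leaves net flow `2 - 1 = 1` across every cut separating `u` from `v`.
  obtain ⟨p₂, hp₂, hp₂F⟩ := exists_isPath_of_sum_pos (O := O) (u := u) (v := v)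
    (F \ p₁.toFinset) fun S hu hv => by
      have := Finset.sum_sdiff (f := fun e => ind S (O.tail e) - ind S (O.head e)) hsub
      rw [hsum, hp₁.sum_sub] at this
      simp only [ind, hu, hv, if_true, if_false] at this ⊢
      linarith
  refine ⟨p₁, p₂, hp₁, hp₂, fun e he he' => ?_⟩
  simpa [he] using hp₂F e he'

/-- Reversing any path from `u` to `v` must destroy strong connectivity. A set with no leaving arc
afterwards had at least one before and lost at most one. -/
theorem StronglyConnected.exists_tight (h : O.StronglyConnected) {u v : V(G)}
    (huv : ¬ O.TwoReaches u v) : ∃ S : Set V(G), u ∈ S ∧ v ∉ S ∧ O.outDegree S = 1 := by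
  obtain ⟨p, hp⟩ := h u v
  have hrev : ¬ (O.reverse p).StronglyConnected := fun h' => huv (hp.twoReaches h')
  rw [stronglyConnected_iff_outDegree_pos] at hrev
  push Not at hrev
  obtain ⟨S, hS, hS', h0⟩ := hrev
  have h1 := h.outDegree_pos hS hS'
  have h2 := hp.outDegree_reverse S
  have hu : u ∈ S := by by_contra hu; simp only [ind, hu] at h2; split_ifs at h2 <;> omega
  have hv : v ∉ S := by intro hv; simp only [ind, hu, hv] at h2; simp at h2; omega
  refine ⟨S, hu, hv, ?_⟩
  simp only [ind, hu, hv] at h2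
  simp at h2
  omega

theorem StronglyConnected.reverse (h : O.StronglyConnected) {u v : V(G)} {p : List E(G)}
    (hp : O.IsPath u p v) (huv : O.TwoReaches u v) : (O.reverse p).StronglyConnected := by
  rw [stronglyConnected_iff_outDegree_pos]
  intro S hS hS'
  have h1 := h.outDegree_pos hS hS'
  have h2 := hp.outDegree_reverse S
  by_cases hu : u ∈ S
  · by_cases hv : v ∈ S
    · simp only [ind, hu, hv, if_true] at h2
      omega
    · have := huv.one_lt_outDegree hu hv
      simp only [ind, hu, hv, if_true, if_false] at h2
      omega
  · simp only [ind, hu, if_false] at h2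
    split_ifs at h2 <;> omega

theorem outDegree_inter_add_outDegree_union_le (S T : Set V(G)) :
    O.outDegree (S ∩ T) + O.outDegree (S ∪ T) ≤ O.outDegree S + O.outDegree T := by
  zify
  simp only [outDegree_eq_sum, ← Finset.sum_add_distrib]
  refine Finset.sum_le_sum fun e _ => ?_
  by_cases h1 : O.tail e ∈ S <;> by_cases h2 : O.tail e ∈ T <;>
  by_cases h3 : O.head e ∈ S <;> by_cases h4 : O.head e ∈ T <;> simp [ind, h1, h2, h3, h4]

theorem outDegree_union_lt {S T : Set V(G)} {e : E(G)} (htS : O.tail e ∈ S) (hhS : O.head e ∉ S)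
    (hh : O.head e ∈ T) :
    O.outDegree (S ∪ T) < O.outDegree S + O.outDegree T := by
  refine lt_of_lt_of_le (Set.ncard_lt_ncard (t := {f | O.tail f ∈ S ∧ O.head f ∉ S} ∪
    {f | O.tail f ∈ T ∧ O.head f ∉ T}) ?_ (Set.toFinite _)) (Set.ncard_union_le _ _)
  refine ⟨fun f hf => ?_, fun hsub => (hsub (Or.inl ⟨htS, hhS⟩)).2 (Or.inr hh)⟩
  simp only [Set.mem_union, Set.mem_ofPred_eq] at hf ⊢
  tauto

/-- Since `v` lies outside, the union has outdegree at least one. If the sets meet, so does the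
intersection, and submodularity gives `1 + 1 ≤ 1 + 1`; if they are disjoint, the arc from `S` to `T`
does not leave the union. -/
theorem StronglyConnected.outDegree_union_eq_one (h : O.StronglyConnected) {v : V(G)}
    {S T : Set V(G)} (hvS : v ∉ S) (hvT : v ∉ T) (hS : O.outDegree S = 1)
    (hT : O.outDegree T = 1)
    (hST : (S ∩ T).Nonempty ∨ ∃ e, O.tail e ∈ S ∧ O.head e ∈ T) :
    O.outDegree (S ∪ T) = 1 := by
  have hne : (S ∪ T).Nonempty := by
    rcases hST with ⟨x, hx⟩ | ⟨e, he⟩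
    exacts [⟨x, Or.inl hx.1⟩, ⟨_, Or.inl he.1⟩]
  have h1 := h.outDegree_pos hne ⟨v, by simp [hvS, hvT]⟩
  by_cases hI : (S ∩ T).Nonempty
  · have h2 := h.outDegree_pos hI ⟨v, by simp [hvS]⟩
    have h3 := O.outDegree_inter_add_outDegree_union_le S T
    omega
  · obtain ⟨e, he, he'⟩ := hST.resolve_left hI
    have h2 := outDegree_union_lt he (fun h => hI ⟨_, h, he'⟩) he'
    omega

end Reversal

/-! ### Arcs entering `U` versus components of `G[V \ U]` -/

section Components

/-- The arcs that enter the set `U` of vertices. -/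
def entering (O : G.Orientation) (U : Set α) : Set E(G) :=
  {e | (O.tail e : α) ∉ U ∧ (O.head e : α) ∈ U}

theorem mem_entering {U : Set α} {e : E(G)} :
    e ∈ O.entering U ↔ (O.tail e : α) ∉ U ∧ (O.head e : α) ∈ U :=
  Iff.rfl

theorem mem_deleteVerts {U : Set α} {x : α} : x ∈ V(G.deleteVerts U) ↔ x ∈ V(G) ∧ x ∉ U := by
  rw [vertexSet_deleteVerts, Set.mem_sdiff]

theorem tail_mem_deleteVerts {U : Set α} (e : O.entering U) :
    (O.tail e : α) ∈ V(G.deleteVerts U) := by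
  exact mem_deleteVerts.2 ⟨(O.tail e).2, e.2.1⟩

/-- The component of `G[V \ U]` from which an arc enters `U`. -/
def enteringComponent (O : G.Orientation) (U : Set α) (e : O.entering U) :
    Quot fun x y : V(G.deleteVerts U) => (G.deleteVerts U).Adj x y :=
  Quot.mk _ ⟨O.tail e, tail_mem_deleteVerts e⟩

theorem numEdgesInside_eq (O : G.Orientation) (U : Set α) :
    G.numEdgesInside U = {e | (O.tail e : α) ∈ U ∧ (O.head e : α) ∈ U}.ncard := by
  rw [numEdgesInside, ← Set.ncard_image_of_injective _ Subtype.val_injective]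
  congr 1
  ext e
  simp only [edgeSet_induce, Set.mem_ofPred_eq, Set.mem_image, Subtype.exists, exists_and_right,
    exists_eq_right]
  constructor
  · rintro ⟨x, y, hxy, hx, hy⟩
    refine ⟨hxy.edge_mem, ?_⟩
    rcases (O.isLink ⟨e, hxy.edge_mem⟩).eq_and_eq_or_eq_and_eq hxy with ⟨h1, h2⟩ | ⟨h1, h2⟩
    · exact ⟨h1.symm ▸ hx, h2.symm ▸ hy⟩
    · exact ⟨h1.symm ▸ hy, h2.symm ▸ hx⟩
  · rintro ⟨he, h⟩
    exact ⟨_, _, O.isLink ⟨e, he⟩, h⟩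

open Classical in
theorem sum_indegree_eq [Fintype E(G)] [Fintype V(G)] (O : G.Orientation) (U : Set α) :
    ∑ v : V(G) with v.1 ∈ U, O.indegree v = G.numEdgesInside U + (O.entering U).ncard := by
  have hdisj : Disjoint {e | (O.tail e : α) ∈ U ∧ (O.head e : α) ∈ U} (O.entering U) :=
    Set.disjoint_left.2 fun e he he' => he'.1 he.1
  rw [O.numEdgesInside_eq, ← Set.ncard_union_eq hdisj, Set.ncard_eq_toFinset_card',
    Finset.card_eq_sum_card_fiberwise (f := O.head) (t := {v : V(G) | v.1 ∈ U})]
  · refine Finset.sum_congr rfl fun v hv => ?_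
    rw [indegree, Set.ncard_eq_toFinset_card']
    congr 1
    ext e
    simp only [Finset.mem_filter, Finset.mem_univ, true_and] at hv
    simp only [Finset.mem_filter, Set.mem_toFinset, Set.mem_union, mem_entering]
    simp only [Set.mem_ofPred_eq]
    constructor
    · rintro rfl
      tauto
    · exact fun h => h.2
  · intro e he
    simp only [Set.coe_toFinset, Set.mem_union, mem_entering] at he
    simp only [Finset.coe_filter, Finset.mem_univ, true_and, Set.mem_ofPred_eq]
    exact he.elim And.right And.right

/-- An arc leaving a component of `G[V \ U]` can only end in `U`, so every component is hit by
`enteringComponent`. -/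
theorem StronglyConnected.numComponentsOutside_le [Fintype E(G)] (h : O.StronglyConnected)
    {U : Set α} (hU : U ⊆ V(G)) (hne : U.Nonempty) :
    G.numComponentsOutside U ≤ (O.entering U).ncard := by
  rw [← Nat.card_coe_set_eq]
  refine Nat.card_le_card_of_surjective (O.enteringComponent U) fun q => ?_
  obtain ⟨x, rfl⟩ := Quot.exists_rep q
  obtain ⟨y, hy⟩ := hne
  obtain ⟨e, ⟨h1, h2⟩, h3⟩ := stronglyConnected_iff.1 h
    {w | ∃ hw : w.1 ∈ V(G.deleteVerts U), Quot.mk _ ⟨w.1, hw⟩ =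
      (Quot.mk _ x : Quot fun x y : V(G.deleteVerts U) => (G.deleteVerts U).Adj x y)}
    ⟨⟨x, (mem_deleteVerts.1 x.2).1⟩, x.2, rfl⟩
    ⟨⟨y, hU hy⟩, fun ⟨hw, _⟩ => (mem_deleteVerts.1 hw).2 hy⟩
  have ht : (O.tail e : α) ∉ U := (mem_deleteVerts.1 h1).2
  have hh : (O.head e : α) ∈ U := by
    by_contra hh
    have hh' : (O.head e : α) ∈ V(G.deleteVerts U) :=
      mem_deleteVerts.2 ⟨(O.head e).2, hh⟩
    refine h3 ⟨hh', ?_⟩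
    rw [← h2]
    exact (Quot.sound ⟨e, (G.deleteVerts_isLink U).2 ⟨O.isLink e, ht, hh⟩⟩).symm
  exact ⟨⟨e, ht, hh⟩, h2⟩

/-- Two vertices in the same component of the graph without the vertices that two-reach `v` lie in
a common set that avoids `v` and is left by a single arc. -/
theorem StronglyConnected.exists_tight_of_eqvGen [Fintype E(G)] (h : O.StronglyConnected)
    {v : V(G)} {U : Set α} (hU : ∀ w : V(G), w.1 ∈ U ↔ O.TwoReaches w v) {x y : V(G.deleteVerts U)}
    (hxy : Relation.EqvGen (fun x y : V(G.deleteVerts U) => (G.deleteVerts U).Adj x y) x y) :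
    ∃ S : Set V(G), x.1 ∈ Subtype.val '' S ∧ y.1 ∈ Subtype.val '' S ∧ v ∉ S ∧
      O.outDegree S = 1 := by
  have key (x : V(G.deleteVerts U)) :
      ∃ S : Set V(G), x.1 ∈ Subtype.val '' S ∧ v ∉ S ∧ O.outDegree S = 1 := by
    have hx := mem_deleteVerts.1 x.2
    obtain ⟨S, hS, hS'⟩ := h.exists_tight (mt (hU ⟨x, hx.1⟩).2 hx.2)
    exact ⟨S, ⟨_, hS, rfl⟩, hS'⟩
  induction hxy with
  | rel x y hxy =>
    obtain ⟨e, he⟩ := hxy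
    replace he := ((G.deleteVerts_isLink U).1 he).1
    obtain ⟨S, ⟨a, ha, hax⟩, hvS, hS⟩ := key x
    obtain ⟨T, ⟨b, hb, hby⟩, hvT, hT⟩ := key y
    -- The edge joining `x` and `y` may be oriented either way; uncrossing needs an arc in only one
    -- direction.
    have hab : (∃ e, O.tail e ∈ S ∧ O.head e ∈ T) ∨ ∃ e, O.tail e ∈ T ∧ O.head e ∈ S := by
      rcases (O.isLink ⟨e, he.edge_mem⟩).eq_and_eq_or_eq_and_eq he with ⟨h1, h2⟩ | ⟨h1, h2⟩
      · replace h1 := Subtype.val_injective (h1.trans hax.symm)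
        replace h2 := Subtype.val_injective (h2.trans hby.symm)
        exact Or.inl ⟨_, h1.symm ▸ ha, h2.symm ▸ hb⟩
      · replace h1 := Subtype.val_injective (h1.trans hby.symm)
        replace h2 := Subtype.val_injective (h2.trans hax.symm)
        exact Or.inr ⟨_, h1.symm ▸ hb, h2.symm ▸ ha⟩
    refine ⟨S ∪ T, ⟨a, Or.inl ha, hax⟩, ⟨b, Or.inr hb, hby⟩, by simp [hvS, hvT], ?_⟩
    rcases hab with hab | hab
    · exact h.outDegree_union_eq_one hvS hvT hS hT (Or.inr hab)
    · rw [Set.union_comm]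
      exact h.outDegree_union_eq_one hvT hvS hT hS (Or.inr hab)
  | refl x =>
    obtain ⟨S, hx, hS⟩ := key x
    exact ⟨S, hx, hx, hS⟩
  | symm x y _ ih =>
    obtain ⟨S, hx, hy, hS⟩ := ih
    exact ⟨S, hy, hx, hS⟩
  | trans x y z _ _ ih₁ ih₂ =>
    obtain ⟨S, ⟨a, ha, hax⟩, ⟨b, hb, hby⟩, hvS, hS⟩ := ih₁
    obtain ⟨T, ⟨b', hb', hby'⟩, ⟨c, hc, hcz⟩, hvT, hT⟩ := ih₂
    obtain rfl : b' = b := Subtype.val_injective (hby'.trans hby.symm)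
    exact ⟨S ∪ T, ⟨a, Or.inl ha, hax⟩, ⟨c, Or.inr hc, hcz⟩, by simp [hvS, hvT],
      h.outDegree_union_eq_one hvS hvT hS hT (Or.inl ⟨b', hb, hb'⟩)⟩

/-- Two arcs entering `U` from one component would have both tails in a common tight set avoiding
`v`. Their heads two-reach `v`, hence lie outside that set, so both arcs would leave it. -/
theorem StronglyConnected.ncard_entering_le [Fintype E(G)] [Finite V(G)]
    (h : O.StronglyConnected) {v : V(G)} {U : Set α} (hU : ∀ w : V(G), w.1 ∈ U ↔ O.TwoReaches w v) :
    (O.entering U).ncard ≤ G.numComponentsOutside U := by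
  have : Finite V(G.deleteVerts U) :=
    (Set.toFinite V(G)).subset (G.deleteVerts_le (X := U)).vertexSet_mono
  rw [← Nat.card_coe_set_eq]
  refine Nat.card_le_card_of_injective (O.enteringComponent U) fun e f hef => ?_
  by_contra hne
  obtain ⟨S, ⟨a, ha, hae⟩, ⟨b, hb, hbf⟩, hv, hS⟩ :=
    h.exists_tight_of_eqvGen hU (Quot.eqvGen_exact hef)
  obtain rfl := Subtype.val_injective hae
  obtain rfl := Subtype.val_injective hbf
  have hhead (e : O.entering U) : O.head e ∉ S := fun he =>
    (((hU _).1 e.2.2).one_lt_outDegree he hv).ne' hS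
  have : 1 < O.outDegree S := (Set.one_lt_ncard (Set.toFinite _)).2
    ⟨e, ⟨ha, hhead e⟩, f, ⟨hb, hhead f⟩, fun h => hne (Subtype.ext h)⟩
  omega

end Components

/-! ### Termination and the min-max formula -/

section Algorithm

theorem SCPathReversalStep.stronglyConnected {O O' : G.Orientation}
    (h : O.SCPathReversalStep O') : O'.StronglyConnected := by
  obtain ⟨u, v, p, -, hp, rfl⟩ := h
  exact hp.2.2

theorem IsSCPathReversalResult.stronglyConnected (h : O.IsSCPathReversalResult) :
    O.StronglyConnected := by
  obtain ⟨O₀, h₀, h, -⟩ := h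
  induction h with
  | refl => exact h₀
  | tail _ h _ => exact h.stronglyConnected

theorem indegree_le_maxIndegree [Finite V(G)] (O : G.Orientation) (v : V(G)) :
    O.indegree v ≤ O.maxIndegree :=
  le_ciSup (Set.finite_range O.indegree).bddAbove v

theorem card_filter_mem [Fintype V(G)] {U : Set α}
    [DecidablePred fun v : V(G) => v.1 ∈ U] (hU : U ⊆ V(G)) :
    ({v : V(G) | v.1 ∈ U} : Finset V(G)).card = U.ncard := by
  classical
  rw [← Finset.card_image_of_injective _ Subtype.val_injective, ← Set.ncard_coe_finset]
  congr 1
  ext x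
  simpa using fun hx => hU hx

variable [Fintype E(G)] [Fintype V(G)]

theorem SCPathReversalStep.sum_sq_lt {O O' : G.Orientation} (h : O.SCPathReversalStep O') :
    ∑ w, O'.indegree w ^ 2 < ∑ w, O.indegree w ^ 2 := by
  classical
  obtain ⟨u, v, p, -, ⟨hp, hlt, -⟩, rfl⟩ := h
  have huv : u ≠ v := by rintro rfl; omega
  have hvu : v ∈ Finset.univ.erase u := by simp [huv.symm]
  rw [← Finset.add_sum_erase _ _ (Finset.mem_univ u), ← Finset.add_sum_erase _ _ hvu,
    ← Finset.add_sum_erase _ _ (Finset.mem_univ u), ← Finset.add_sum_erase _ _ hvu]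
  have h3 : ∑ w ∈ (Finset.univ.erase u).erase v, (O.reverse p).indegree w ^ 2 =
      ∑ w ∈ (Finset.univ.erase u).erase v, O.indegree w ^ 2 := by
    refine Finset.sum_congr rfl fun w hw => ?_
    simp only [Finset.mem_erase, Finset.mem_univ, and_true] at hw
    have := hp.indegree_reverse w
    simp only [ind, Set.mem_singleton_iff, hw.1.symm, hw.2.symm, if_false] at this
    congr 1
    omega
  have hu := hp.indegree_reverse u
  have hv := hp.indegree_reverse v
  simp only [ind, Set.mem_singleton_iff, huv, huv.symm, if_false, if_true] at hu hv
  rw [h3]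
  zify at hlt ⊢
  rw [hu, hv]
  -- With `a = δ(u)` and `b = δ(v)`, the sum changes by `2 * (a + 1 - b)`, which is negative.
  nlinarith

theorem not_forall_scPathReversalStep (run : ℕ → G.Orientation) :
    ¬ ∀ i, (run i).SCPathReversalStep (run (i + 1)) := fun h =>
  not_strictAnti_of_wellFoundedLT (fun i => ∑ w, (run i).indegree w ^ 2)
    (strictAnti_nat_of_succ_lt fun i => (h i).sum_sq_lt)

theorem exists_isSCPathReversalResult (h : O.StronglyConnected) :
    ∃ O' : G.Orientation, O'.IsSCPathReversalResult := by
  suffices ∀ n (O' : G.Orientation), ∑ w, O'.indegree w ^ 2 = n →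
      Relation.ReflTransGen SCPathReversalStep O O' →
      ∃ O'' : G.Orientation, O''.IsSCPathReversalResult from this _ O rfl .refl
  intro n
  induction n using Nat.strong_induction_on with
  | _ n ih =>
    rintro O' rfl hO'
    by_cases hstep : ∃ O'', SCPathReversalStep O' O''
    · obtain ⟨O'', hO''⟩ := hstep
      exact ih _ hO''.sum_sq_lt O'' rfl (hO'.tail hO'')
    · exact ⟨O', O, h, hO', hstep⟩

theorem StronglyConnected.ceil_le_maxIndegree (h : O.StronglyConnected) {U : Set α}
    (hU : U ⊆ V(G)) (hne : U.Nonempty) :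
    ⌈((G.numEdgesInside U + G.numComponentsOutside U : ℕ) : ℚ) / (U.ncard : ℚ)⌉₊ ≤
      O.maxIndegree := by
  classical
  have hpos : 0 < U.ncard := (Set.ncard_pos ((Set.toFinite V(G)).subset hU)).2 hne
  rw [Nat.ceil_le, div_le_iff₀ (by exact_mod_cast hpos)]
  norm_cast
  calc _ ≤ G.numEdgesInside U + (O.entering U).ncard := by
        gcongr; exact h.numComponentsOutside_le hU hne
    _ = ∑ v : V(G) with v.1 ∈ U, O.indegree v := (O.sum_indegree_eq U).symm
    _ ≤ ∑ v : V(G) with v.1 ∈ U, O.maxIndegree :=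
        Finset.sum_le_sum fun v _ => O.indegree_le_maxIndegree v
    _ = _ := by rw [Finset.sum_const, card_filter_mem hU, smul_eq_mul, mul_comm]

theorem exists_maxIndegree_eq_ceil [Nonempty V(G)] (h : O.StronglyConnected)
    (hO : ¬ ∃ O', O.SCPathReversalStep O') :
    ∃ U : Set α, U ⊆ V(G) ∧ U.Nonempty ∧ O.maxIndegree =
      ⌈((G.numEdgesInside U + G.numComponentsOutside U : ℕ) : ℚ) / (U.ncard : ℚ)⌉₊ := by
  classical
  obtain ⟨v, hv⟩ : ∃ v, O.indegree v = O.maxIndegree := exists_eq_ciSup_of_finite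
  set U : Set α := Subtype.val '' {w : V(G) | O.TwoReaches w v} with hUdef
  have hU (w : V(G)) : w.1 ∈ U ↔ O.TwoReaches w v := Subtype.val_injective.mem_set_image
  have hUV : U ⊆ V(G) := by rintro _ ⟨w, -, rfl⟩; exact w.2
  have hvU : v.1 ∈ U := (hU v).2
    ⟨[], [], ⟨rfl, List.nodup_nil⟩, ⟨rfl, List.nodup_nil⟩, List.disjoint_nil_left _⟩
  refine ⟨U, hUV, ⟨v, hvU⟩, (h.ceil_le_maxIndegree hUV ⟨v, hvU⟩).antisymm' ?_⟩
  -- Otherwise any path from `w` to `v` would be strongly reversible.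
  have hlow (w : V(G)) (hw : w.1 ∈ U) : O.maxIndegree ≤ O.indegree w + 1 := by
    by_contra! hlt
    obtain ⟨p, hp⟩ := h w v
    exact hO ⟨_, w, v, p, fun x => hv ▸ O.indegree_le_maxIndegree x,
      ⟨hp, hv ▸ hlt, h.reverse hp ((hU w).1 hw)⟩, rfl⟩
  have hpos : 0 < U.ncard := (Set.ncard_pos ((Set.toFinite V(G)).subset hUV)).2 ⟨v, hvU⟩
  have hlt : O.maxIndegree * U.ncard < G.numEdgesInside U + G.numComponentsOutside U + U.ncard :=
    calc O.maxIndegree * U.ncard = ∑ w : V(G) with w.1 ∈ U, O.maxIndegree := by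
          rw [Finset.sum_const, card_filter_mem hUV, smul_eq_mul, mul_comm]
      -- Strict because `v` itself lies in `U` and attains the maximum; this is what makes the
      -- ceiling exact.
      _ < ∑ w : V(G) with w.1 ∈ U, (O.indegree w + 1) :=
          Finset.sum_lt_sum (fun w hw => hlow w (by simpa using hw))
            ⟨v, by simpa using hvU, by omega⟩
      _ = G.numEdgesInside U + (O.entering U).ncard + U.ncard := by
          rw [Finset.sum_add_distrib, O.sum_indegree_eq U, ← Finset.card_eq_sum_ones,
            card_filter_mem hUV]
      _ ≤ _ := by gcongr; exact h.ncard_entering_le hU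
  refine Nat.le_of_lt_succ ?_
  have hq : (0 : ℚ) < U.ncard := by exact_mod_cast hpos
  have h2 : (O.maxIndegree : ℚ) * U.ncard <
      ((G.numEdgesInside U + G.numComponentsOutside U : ℕ) : ℚ) + U.ncard := by exact_mod_cast hlt
  have h3 : (O.maxIndegree : ℚ) <
      ((G.numEdgesInside U + G.numComponentsOutside U : ℕ) : ℚ) / U.ncard + 1 := by
    rw [div_add_one hq.ne', lt_div_iff₀ hq]
    exact h2
  have h4 := Nat.le_ceil (((G.numEdgesInside U + G.numComponentsOutside U : ℕ) : ℚ) / U.ncard)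
  have h5 : (O.maxIndegree : ℚ) <
      (⌈((G.numEdgesInside U + G.numComponentsOutside U : ℕ) : ℚ) / U.ncard⌉₊ : ℚ) + 1 := by
    linarith
  exact_mod_cast h5

end Algorithm

end Orientation

end Graph

theorem mainTheorem4 {α β : Type*} (G : Graph α β)
    (hV : V(G).Finite) (hne : V(G).Nonempty) (hE : E(G).Finite)
    (hG : ∃ O : G.Orientation, O.StronglyConnected) :
    -- SC-Path-Reversal terminates: from no strongly connected orientation, and for no choice of
    -- the paths, does it run forever; and it has a result
    (∀ run : ℕ → G.Orientation, (run 0).StronglyConnected →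
      ¬ ∀ i, (run i).SCPathReversalStep (run (i + 1))) ∧
    (∃ O : G.Orientation, O.IsSCPathReversalResult) ∧
    -- every result is a strongly connected orientation of minimum maximum indegree, and its
    -- maximum indegree is the largest value of the lower bound
    (∀ O : G.Orientation, O.IsSCPathReversalResult →
      O.StronglyConnected ∧
      (∀ O' : G.Orientation, O'.StronglyConnected → O.maxIndegree ≤ O'.maxIndegree) ∧
      IsGreatest {b : ℕ | ∃ U : Set α, U ⊆ V(G) ∧ U.Nonempty ∧
        b = ⌈((G.numEdgesInside U + G.numComponentsOutside U : ℕ) : ℚ) / (U.ncard : ℚ)⌉₊}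
        O.maxIndegree) ∧
    -- reversing a path maintains strong connectivity if and only if its first vertex
    -- two-reaches its last vertex
    (∀ O : G.Orientation, O.StronglyConnected →
      ∀ (u v : V(G)) (p : List E(G)), O.IsPath u p v →
        ((O.reverse p).StronglyConnected ↔ O.TwoReaches u v)) := by
  have := hE.fintype
  have := hV.fintype
  have : Nonempty V(G) := hne.to_subtype
  refine ⟨fun run _ => Graph.Orientation.not_forall_scPathReversalStep run, ?_, ?_, ?_⟩
  · obtain ⟨O, hO⟩ := hG
    exact Graph.Orientation.exists_isSCPathReversalResult hO
  · intro O hO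
    have hsc := hO.stronglyConnected
    obtain ⟨_, _, _, hfinal⟩ := hO
    obtain ⟨U, hU, hUne, heq⟩ := Graph.Orientation.exists_maxIndegree_eq_ceil hsc hfinal
    refine ⟨hsc, fun O' hO' => ?_, ⟨U, hU, hUne, heq⟩, ?_⟩
    · rw [heq]
      exact hO'.ceil_le_maxIndegree hU hUne
    · rintro _ ⟨W, hW, hWne, rfl⟩
      exact hsc.ceil_le_maxIndegree hW hWne
  · exact fun O hO u v p hp => ⟨hp.twoReaches, hO.reverse hp⟩
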